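/- Consider the following problem. Let $f_1,\dots,f_n:\mathbb{R}^D\to\mathbb{R}$ be convex and $L$-Lipschitz with respect to the Euclidean norm, where $f_i$ depends exactly on the coordinates in a set $S_i\subseteq\{1,\dots,D\}$ of size $d_i$, and let $m=\sum_{i=1}^n d_i$. Let $\theta^\star$ be a minimizer of $\sum_i f_i$, and let $\theta^{(0)}$ satisfy $\|\theta^{(0)}-\theta^\star\|_2\le R$. A query consists of an index $i$ and a point $\theta\in\mathbb{R}^D$, and is answered by an oracle with the value $f_i(\theta)$ and a subgradient of $f_i$ at $\theta$ (the oracle fixes one subgradient for each $i$ and $\theta$). The goal is to output $\theta$ with $\sum_i f_i(\theta)\le \epsilon LR+\sum_i f_i(\theta^\star)$. **Theorem (lower bound).** For every $\alpha>1/2$ there is a constant $c=c(\alpha)>0$ with the following property. Let $n, D\ge 0$, let $S_1,\dots,S_n\subseteq\{1,\dots,D\}$ be pairwise disjoint with $d_i=|S_i|$ and $m=\sum_i d_i$ (so that $n$ and $d_1,\dots,d_n$ are arbitrary), and let $L,R>0$, $\theta^{(0)}\in\mathbb{R}^D$ and $0<\epsilon\le m^{-\alpha}$. Then $\Omega(m\log(1/\epsilon))$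 queries in total are required to solve the problem. More precisely, let $T<c\,m\log(1/\epsilon)$ be a natural number and consider any adaptive algorithm, deterministic or randomized, which may know $n,D,S_1,\dots,S_n,L,R,\epsilon$ and $\theta^{(0)}$. There exist convex $L$-Lipschitz functions $f_1,\dots,f_n$ on $\mathbb{R}^D$, with $f_i$ depending exactly on the coordinates in $S_i$, a minimizer $\theta^\star$ of $\sum_i f_i$ with $\|\theta^{(0)}-\theta^\star\|_2\le R$, and a subgradient oracle for $f_1,\dots,f_n$, on which with probability greater than $1/3$ the algorithm fails to output, after at most $T$ queries in total, a point $\theta$ with $\sum_i f_i(\theta)\le\epsilon LR+\sum_i f_i(\theta^\star)$. (For a deterministic algorithm this means that it fails.) -/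

import Mathlib

open scoped NNReal ENNReal

/-- `v` is a subgradient of `f` at `x`. -/
def IsSubgradientAt {D : ℕ} (f : EuclideanSpace ℝ (Fin D) → ℝ)
    (v x : EuclideanSpace ℝ (Fin D)) : Prop :=
  ∀ y, f x + inner ℝ v (y - x) ≤ f y

/-- The set of coordinates on which `f` depends is exactly `S`: the value of `f` is determined by
the coordinates in `S`, and for every coordinate in `S` changing that coordinate alone can change
the value of `f`. -/
def DependsExactlyOn {D : ℕ} (f : EuclideanSpace ℝ (Fin D) → ℝ) (S : Finset (Fin D)) : Prop :=
  (∀ x y : EuclideanSpace ℝ (Fin D), (∀ j ∈ S, x j = y j) → f x = f y) ∧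
  (∀ j ∈ S, ∃ x y : EuclideanSpace ℝ (Fin D), (∀ k, k ≠ j → x k = y k) ∧ f x ≠ f y)

/-- `f 0, …, f (n-1)` with the minimizer `xopt` of their sum are a valid instance of decomposable
convex minimization with coordinate sets `S i`, Lipschitz constant `L`, initial point `x₀` and
radius `R`. -/
structure IsDecomposableInstance {n D : ℕ} (S : Fin n → Finset (Fin D)) (L : ℝ≥0) (R : ℝ)
    (x₀ : EuclideanSpace ℝ (Fin D)) (f : Fin n → EuclideanSpace ℝ (Fin D) → ℝ)
    (xopt : EuclideanSpace ℝ (Fin D)) : Prop where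
  convex : ∀ i, ConvexOn ℝ Set.univ (f i)
  lipschitz : ∀ i, LipschitzWith L (f i)
  dependsOn : ∀ i, DependsExactlyOn (f i) (S i)
  isMin : ∀ x, ∑ i, f i xopt ≤ ∑ i, f i x
  dist_le : ‖x₀ - xopt‖ ≤ R

/-- `g` is a subgradient oracle for `f 0, …, f (n-1)`: the answer of the oracle for `f i` at `x` is
the subgradient `g i x`. -/
def IsSubgradientOracle {n D : ℕ} (f : Fin n → EuclideanSpace ℝ (Fin D) → ℝ)
    (g : Fin n → EuclideanSpace ℝ (Fin D) → EuclideanSpace ℝ (Fin D)) : Prop :=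
  ∀ i x, IsSubgradientAt (f i) (g i x) x

/-- A deterministic adaptive algorithm with oracle access to `n` functions on `ℝ^D`, as a decision
tree of arbitrary (uncomputable) power: it either stops with an output, or queries the `i`-th
function at `x` and continues depending on the value and the subgradient that it is told. -/
inductive QueryAlgorithm (n D : ℕ) : Type
  | output (x : EuclideanSpace ℝ (Fin D)) : QueryAlgorithm n D
  | query (i : Fin n) (x : EuclideanSpace ℝ (Fin D))
      (next : ℝ → EuclideanSpace ℝ (Fin D) → QueryAlgorithm n D) : QueryAlgorithm n D

namespace QueryAlgorithm

/-- The point that the algorithm outputs when its queries are answered by `f` and `g`. -/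
def result {n D : ℕ} (f : Fin n → EuclideanSpace ℝ (Fin D) → ℝ)
    (g : Fin n → EuclideanSpace ℝ (Fin D) → EuclideanSpace ℝ (Fin D)) :
    QueryAlgorithm n D → EuclideanSpace ℝ (Fin D)
  | output x => x
  | query i x next => result f g (next (f i x) (g i x))

/-- The total number of queries, to all the functions, that the algorithm makes when its queries
are answered by `f` and `g`. -/
def numQueries {n D : ℕ} (f : Fin n → EuclideanSpace ℝ (Fin D) → ℝ)
    (g : Fin n → EuclideanSpace ℝ (Fin D) → EuclideanSpace ℝ (Fin D)) :
    QueryAlgorithm n D → ℕ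
  | output _ => 0
  | query i x next => numQueries f g (next (f i x) (g i x)) + 1

end QueryAlgorithm

/-!
# A query lower bound for decomposable convex minimization

The hard instances are steered by hidden random bits, `K ≈ log (1 / ε)` of them for each of the
`m` coordinates that occur in a block. In one dimension, `nest K b` is `|w|` modified near its
minimum by a flatter and narrower copy of `nest (K - 1)`, whose centre is moved to the right or to
the left according to the first bit of `b`. The key property is `nest_le_of_wrongSide`: as soon as
one of the bits moves the minimizer away from the query point, the value there does not depend on
later bits, and it is at least the value for any other choice of that bit and of the later ones.
The function of a block is the maximum of such functions, one for each coordinate, shifted to have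
minimum `0`; the oracle takes the subgradient from the first coordinate that attains the maximum.

A query can therefore be answered by revealing bits one at a time: always reveal the next bit of
the first coordinate whose value has the largest upper bound given the bits that are already known
(`exists_bit_settles_block`). With probability `1 / 2` that bit makes the upper bound exact, and
then the coordinate attains the maximum and determines the whole answer. So a query reveals a number
of bits that is dominated by a geometric distribution, no matter how large the block is. A point
solves the problem only if it is on the right side at each level of each coordinate, which has
probability at most `1 / 2` as long as a bit is hidden. By induction over the algorithm, the
probability of solving the problem with `T` queries while `u` bits are hidden is at most
`1 / 2 + 2 ^ T * (3 / 4) ^ u` (`card_filter_success_le`), which is less than `2 / 3` if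
`u = m * K` is at least `12 * T > 0`. Averaging over the bits yields one instance that is hard for a
given randomized algorithm (`exists_le_measure_of_forall_card`).

The minimizer is confined to a cube of half-width `R / √m`, so the accuracy relative to that cube is
`ε * √m`, which is at most `ε ^ (1 - 1 / (2 * α))` (`mul_sqrt_le_rpow`); here `α > 1 / 2` is used.
The case `T = 0`, in which `ε` may be arbitrarily close to `1`, is settled by two instances
(`exists_hard_instance_of_zero_queries`).
-/

/-! ### Nested one-dimensional functions -/

/-- The sign `±1` encoded by a bit. -/
noncomputable def bitSign (v : Bool) : ℝ := if v then 1 else -1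

lemma abs_three_mul_bitSign (v : Bool) : |3 * bitSign v| = 3 := by
  cases v <;> norm_num [bitSign]

/-- The one-dimensional hard function of depth `K` steered by the bits `b`: the function `|w|`,
modified near its minimum by a copy of the function of depth `K - 1` that is flatter by the factor
`2`, narrower by the factor `4`, and centred to the right or to the left of `0` according to the
first bit. The constants are such that the copy exceeds `|w|` only where `|w| < 3`, and that a point
from which the centre of the copy has been moved away is at distance at least `3` from that centre
in the coordinates of the copy; hence the modifications inside the copy vanish there. Only the
first `K` bits are used. -/
noncomputable def nest : ℕ → (ℕ → Bool) → ℝ → ℝ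
  | 0, _, w => |w|
  | K + 1, b, w => max |w| (nest K (fun k => b (k + 1)) (4 * w - 3 * bitSign (b 0)) / 8 + 1)

/-- A subgradient of `nest K b` at `w`: the slope of an affine piece that is active at `w`. -/
noncomputable def nestSlope : ℕ → (ℕ → Bool) → ℝ → ℝ
  | 0, _, w => Real.sign w
  | K + 1, b, w =>
    if nest K (fun k => b (k + 1)) (4 * w - 3 * bitSign (b 0)) / 8 + 1 ≤ |w| then Real.sign w
    else nestSlope K (fun k => b (k + 1)) (4 * w - 3 * bitSign (b 0)) / 2

/-- The minimum of `nest K b`, which does not depend on `b`. -/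
noncomputable def nestMin : ℕ → ℝ
  | 0 => 0
  | K + 1 => nestMin K / 8 + 1

/-- The minimizer of `nest K b`. -/
noncomputable def nestArgmin : ℕ → (ℕ → Bool) → ℝ
  | 0, _ => 0
  | K + 1, b => (3 * bitSign (b 0) + nestArgmin K (fun k => b (k + 1))) / 4

/-- The point `w` lies on the wrong side at level `k`: relative to the centre given by the bits
before the `k`-th one (counting from `0`), the `k`-th bit moves the minimizer away from `w`. The
centre itself is on the wrong side for both values of the bit. -/
def WrongSide : ℕ → (ℕ → Bool) → ℝ → Prop
  | 0, b, w => bitSign (b 0) * w ≤ 0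
  | k + 1, b, w => WrongSide k (fun l => b (l + 1)) (4 * w - 3 * bitSign (b 0))

lemma abs_nestArgmin_le (K : ℕ) (b : ℕ → Bool) : |nestArgmin K b| ≤ 1 := by
  induction K generalizing b with
  | zero => simp [nestArgmin]
  | succ K ih =>
    have h1 := abs_le.1 (ih fun k => b (k + 1))
    have h2 := abs_le.1 (abs_three_mul_bitSign (b 0)).le
    rw [nestArgmin, abs_le]
    constructor <;> linarith

lemma nestMin_nonneg (K : ℕ) : 0 ≤ nestMin K := by
  induction K with
  | zero => simp [nestMin]
  | succ K ih => rw [nestMin]; positivity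

lemma nestMin_le (K : ℕ) : nestMin K ≤ 8 / 7 := by
  induction K with
  | zero => norm_num [nestMin]
  | succ K ih => rw [nestMin]; linarith

lemma nest_nestArgmin (K : ℕ) (b : ℕ → Bool) : nest K b (nestArgmin K b) = nestMin K := by
  induction K generalizing b with
  | zero => simp [nest, nestArgmin, nestMin]
  | succ K ih =>
    have h1 := abs_nestArgmin_le (K + 1) b
    have h2 : 4 * nestArgmin (K + 1) b - 3 * bitSign (b 0) = nestArgmin K fun k => b (k + 1) := by
      rw [nestArgmin]; ring
    have h3 := nestMin_nonneg K
    rw [nest, h2, ih, nestMin, max_eq_right]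
    linarith

lemma nestMin_le_nest (K : ℕ) (b : ℕ → Bool) (w : ℝ) : nestMin K ≤ nest K b w := by
  induction K generalizing b w with
  | zero => simp [nest, nestMin]
  | succ K ih =>
    rw [nest, nestMin]
    exact le_max_of_le_right (by linarith [ih (fun k => b (k + 1)) (4 * w - 3 * bitSign (b 0))])

lemma abs_le_nest (K : ℕ) (b : ℕ → Bool) (w : ℝ) : |w| ≤ nest K b w := by
  cases K with
  | zero => exact le_rfl
  | succ K => exact le_max_left _ _

lemma abs_nestSlope_le (K : ℕ) (b : ℕ → Bool) (w : ℝ) : |nestSlope K b w| ≤ 1 := by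
  have hsign : ∀ w : ℝ, |Real.sign w| ≤ 1 := fun w => by
    rcases Real.sign_apply_eq w with h | h | h <;> simp [h]
  induction K generalizing b w with
  | zero => exact hsign w
  | succ K ih =>
    rw [nestSlope]
    split_ifs
    · exact hsign w
    · have h1 := abs_le.1 (ih (fun k => b (k + 1)) (4 * w - 3 * bitSign (b 0)))
      rw [abs_le]
      constructor <;> linarith

lemma abs_add_sign_mul_le (w w' : ℝ) : |w| + Real.sign w * (w' - w) ≤ |w'| := by
  rcases lt_trichotomy w 0 with h | h | h
  · rw [Real.sign_of_neg h, abs_of_neg h]; linarith [neg_abs_le w']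
  · simp [h]
  · rw [Real.sign_of_pos h, abs_of_pos h]; linarith [le_abs_self w']

lemma nest_add_nestSlope_mul_le (K : ℕ) (b : ℕ → Bool) (w w' : ℝ) :
    nest K b w + nestSlope K b w * (w' - w) ≤ nest K b w' := by
  induction K generalizing b w w' with
  | zero => exact abs_add_sign_mul_le w w'
  | succ K ih =>
    rw [nestSlope, nest, nest]
    split_ifs with h
    · rw [max_eq_left h]
      exact le_max_of_le_left (abs_add_sign_mul_le w w')
    · rw [max_eq_right (not_le.1 h).le]
      refine le_max_of_le_right ?_
      linarith [ih (fun k => b (k + 1)) (4 * w - 3 * bitSign (b 0)) (4 * w' - 3 * bitSign (b 0))]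

/-- The modifications stay below `max |w| 3`. -/
lemma nest_le_max (K : ℕ) (b : ℕ → Bool) (w : ℝ) : nest K b w ≤ max |w| 3 := by
  induction K generalizing b w with
  | zero => exact le_max_left _ _
  | succ K ih =>
    rw [nest]
    refine max_le (le_max_left _ _) ?_
    have h1 := ih (fun k => b (k + 1)) (4 * w - 3 * bitSign (b 0))
    have h2 : |4 * w - 3 * bitSign (b 0)| ≤ 4 * |w| + 3 := by
      refine (abs_sub _ _).trans ?_
      rw [abs_three_mul_bitSign, abs_mul, abs_of_pos (by norm_num : (0 : ℝ) < 4)]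
    have h3 : max |4 * w - 3 * bitSign (b 0)| 3 ≤ 4 * |w| + 3 :=
      max_le h2 (by linarith [abs_nonneg w])
    have h4 := le_max_left |w| 3
    have h5 := le_max_right |w| 3
    linarith

lemma nest_eq_abs (K : ℕ) (b : ℕ → Bool) {w : ℝ} (hw : 3 ≤ |w|) : nest K b w = |w| :=
  le_antisymm ((nest_le_max K b w).trans (max_le le_rfl hw)) (abs_le_nest K b w)

lemma nestSlope_eq_sign (K : ℕ) (b : ℕ → Bool) {w : ℝ} (hw : 3 ≤ |w|) :
    nestSlope K b w = Real.sign w := by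
  cases K with
  | zero => rfl
  | succ K =>
    rw [nestSlope, if_pos]
    have h := nest_eq_abs (K + 1) b hw
    rw [nest] at h
    exact max_eq_left_iff.1 h

lemma abs_of_wrongSide_zero {v : Bool} {w : ℝ} (h : bitSign v * w ≤ 0) :
    |4 * w - 3 * bitSign v| = 4 * |w| + 3 := by
  cases v
  · have : 0 ≤ w := by simpa [bitSign] using h
    rw [abs_of_nonneg this, abs_of_nonneg] <;> norm_num [bitSign]
    linarith
  · have : w ≤ 0 := by simpa [bitSign] using h
    rw [abs_of_nonpos this, abs_of_nonpos] <;> norm_num [bitSign] <;> linarith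

/-- Among all continuations of the first `k` bits, those for which `w` is on the wrong side at
level `k` give the largest value at `w`. In particular that value does not depend on later bits. -/
lemma nest_le_of_wrongSide {K k : ℕ} {b b' : ℕ → Bool} {w : ℝ} (hk : k < K)
    (hw : WrongSide k b w) (hb : ∀ l < k, b' l = b l) : nest K b' w ≤ nest K b w := by
  induction k generalizing K b b' w with
  | zero =>
    obtain ⟨K, rfl⟩ : ∃ K', K = K' + 1 := ⟨K - 1, by omega⟩
    have h1 := abs_of_wrongSide_zero hw
    have h2 := nest_le_max K (fun k => b' (k + 1)) (4 * w - 3 * bitSign (b' 0))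
    have h3 := abs_le_nest K (fun k => b (k + 1)) (4 * w - 3 * bitSign (b 0))
    have h4 : |4 * w - 3 * bitSign (b' 0)| ≤ 4 * |w| + 3 := by
      refine (abs_sub _ _).trans ?_
      rw [abs_three_mul_bitSign, abs_mul, abs_of_pos (by norm_num : (0 : ℝ) < 4)]
    have h5 : max |4 * w - 3 * bitSign (b' 0)| 3 ≤ 4 * |w| + 3 :=
      max_le h4 (by linarith [abs_nonneg w])
    rw [nest, nest]
    exact max_le_max le_rfl (by linarith)
  | succ k ih =>
    obtain ⟨K, rfl⟩ : ∃ K', K = K' + 1 := ⟨K - 1, by omega⟩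
    have h := ih (K := K) (b := fun l => b (l + 1)) (b' := fun l => b' (l + 1)) (by omega) hw
      fun l hl => hb (l + 1) (by omega)
    rw [nest, nest, hb 0 (by omega)]
    exact max_le_max le_rfl (by linarith)

lemma WrongSide.congr {k : ℕ} {b b' : ℕ → Bool} {w : ℝ} (hw : WrongSide k b w)
    (hb : ∀ l ≤ k, b' l = b l) : WrongSide k b' w := by
  induction k generalizing b b' w with
  | zero => simpa only [WrongSide, hb 0 le_rfl] using hw
  | succ k ih =>
    rw [WrongSide] at hw ⊢
    rw [hb 0 (by omega)]
    exact ih hw fun l hl => hb (l + 1) (by omega)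

lemma nest_eq_of_wrongSide {K k : ℕ} {b b' : ℕ → Bool} {w : ℝ} (hk : k < K)
    (hw : WrongSide k b w) (hb : ∀ l ≤ k, b' l = b l) : nest K b' w = nest K b w :=
  le_antisymm (nest_le_of_wrongSide hk hw fun l hl => hb l hl.le)
    (nest_le_of_wrongSide hk (hw.congr hb) fun l hl => (hb l hl.le).symm)

lemma nestSlope_eq_of_wrongSide {K k : ℕ} {b b' : ℕ → Bool} {w : ℝ} (hk : k < K)
    (hw : WrongSide k b w) (hb : ∀ l ≤ k, b' l = b l) : nestSlope K b' w = nestSlope K b w := by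
  induction k generalizing K b b' w with
  | zero =>
    obtain ⟨K, rfl⟩ : ∃ K', K = K' + 1 := ⟨K - 1, by omega⟩
    have h1 : 3 ≤ |4 * w - 3 * bitSign (b 0)| := by
      rw [abs_of_wrongSide_zero hw]; linarith [abs_nonneg w]
    rw [nestSlope, nestSlope, hb 0 le_rfl, nest_eq_abs _ _ h1, nest_eq_abs _ _ h1,
      nestSlope_eq_sign _ _ h1, nestSlope_eq_sign _ _ h1]
  | succ k ih =>
    obtain ⟨K, rfl⟩ : ∃ K', K = K' + 1 := ⟨K - 1, by omega⟩
    rw [WrongSide] at hw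
    have hb' : ∀ l ≤ k, (fun l => b' (l + 1)) l = (fun l => b (l + 1)) l :=
      fun l hl => hb (l + 1) (by omega)
    rw [nestSlope, nestSlope, hb 0 (by omega), ih (by omega) hw hb',
      nest_eq_of_wrongSide (by omega) hw hb']

lemma nest_congr {K : ℕ} {b b' : ℕ → Bool} (hb : ∀ l < K, b' l = b l) (w : ℝ) :
    nest K b' w = nest K b w := by
  induction K generalizing b b' w with
  | zero => rfl
  | succ K ih =>
    rw [nest, nest, hb 0 (by omega), ih (b := fun l => b (l + 1)) (b' := fun l => b' (l + 1))
      fun l hl => hb (l + 1) (by omega)]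

lemma exists_wrongSide (k : ℕ) (b : ℕ → Bool) (w : ℝ) :
    ∃ v, WrongSide k (Function.update b k v) w := by
  induction k generalizing b w with
  | zero =>
    rcases le_total w 0 with h | h
    · exact ⟨true, by simpa [WrongSide, bitSign] using h⟩
    · exact ⟨false, by simpa [WrongSide, bitSign] using h⟩
  | succ k ih =>
    obtain ⟨v, hv⟩ := ih (fun l => b (l + 1)) (4 * w - 3 * bitSign (b 0))
    refine ⟨v, ?_⟩
    rw [WrongSide, Function.update_of_ne (by omega)]
    refine hv.congr fun l _ => ?_
    by_cases hl : l = k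
    · subst hl; simp
    · rw [Function.update_of_ne (by omega), Function.update_of_ne hl]

/-- A point on the wrong side at some level is far from optimal. -/
lemma pow_le_nest_sub_of_wrongSide {K k : ℕ} {b : ℕ → Bool} {w : ℝ} (hk : k < K)
    (hw : WrongSide k b w) : (1 / 8) ^ K ≤ nest K b w - nestMin K := by
  induction k generalizing K b w with
  | zero =>
    obtain ⟨K, rfl⟩ : ∃ K', K = K' + 1 := ⟨K - 1, by omega⟩
    have h1 := abs_of_wrongSide_zero hw
    have h2 := abs_le_nest K (fun k => b (k + 1)) (4 * w - 3 * bitSign (b 0))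
    have h3 := nestMin_le (K + 1)
    have h4 : nest K (fun k => b (k + 1)) (4 * w - 3 * bitSign (b 0)) / 8 + 1 ≤ nest (K + 1) b w :=
      le_max_right _ _
    have h5 : (1 / 8 : ℝ) ^ K ≤ 1 := pow_le_one₀ (by norm_num) (by norm_num)
    rw [pow_succ]
    linarith [abs_nonneg w]
  | succ k ih =>
    obtain ⟨K, rfl⟩ : ∃ K', K = K' + 1 := ⟨K - 1, by omega⟩
    have h := ih (K := K) (by omega) hw
    have h4 : nest K (fun k => b (k + 1)) (4 * w - 3 * bitSign (b 0)) / 8 + 1 ≤ nest (K + 1) b w :=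
      le_max_right _ _
    rw [pow_succ, nestMin]
    linarith

/-! ### Instances built from one-dimensional functions -/

/-- A convex `1`-Lipschitz function `val` on the line with minimum `0`, attained at the point
`argmin` of `[-1, 1]`, which is not identically `0`, together with a choice `slope` of
subgradients. -/
structure Profile where
  /-- The function. -/
  val : ℝ → ℝ
  /-- The chosen subgradient at each point. -/
  slope : ℝ → ℝ
  /-- The distinguished minimizer. -/
  argmin : ℝ
  val_add_slope_mul_le : ∀ w w', val w + slope w * (w' - w) ≤ val w'
  abs_slope_le : ∀ w, |slope w| ≤ 1
  val_nonneg : ∀ w, 0 ≤ val w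
  val_argmin : val argmin = 0
  abs_argmin_le : |argmin| ≤ 1
  exists_val_ne : ∃ w, val w ≠ 0

/-- The profile `nest K b - nestMin K`. -/
noncomputable def nestProfile (K : ℕ) (b : ℕ → Bool) : Profile where
  val w := nest K b w - nestMin K
  slope := nestSlope K b
  argmin := nestArgmin K b
  val_add_slope_mul_le w w' := by linarith [nest_add_nestSlope_mul_le K b w w']
  abs_slope_le := abs_nestSlope_le K b
  val_nonneg w := sub_nonneg.2 (nestMin_le_nest K b w)
  val_argmin := sub_eq_zero.2 (nest_nestArgmin K b)
  abs_argmin_le := abs_nestArgmin_le K b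
  exists_val_ne := by
    refine ⟨3, ?_⟩
    have := abs_le_nest K b 3
    rw [abs_of_pos (by norm_num)] at this
    linarith [nestMin_le K]

/-- The profile `|w - bitSign v|`. -/
noncomputable def absProfile (v : Bool) : Profile where
  val w := |w - bitSign v|
  slope w := Real.sign (w - bitSign v)
  argmin := bitSign v
  val_add_slope_mul_le w w' := by
    simpa using abs_add_sign_mul_le (w - bitSign v) (w' - bitSign v)
  abs_slope_le w := by
    rcases Real.sign_apply_eq (w - bitSign v) with h | h | h <;> simp [h]
  val_nonneg w := abs_nonneg _
  val_argmin := by simp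
  abs_argmin_le := by cases v <;> norm_num [bitSign]
  exists_val_ne := ⟨0, by cases v <;> norm_num [bitSign]⟩

/-- `j` is the first element of `S` at which `v` attains its maximum over `S`. -/
def IsFirstMax {D : ℕ} (S : Finset (Fin D)) (v : Fin D → ℝ) (j : Fin D) : Prop :=
  j ∈ S ∧ (∀ k ∈ S, v k ≤ v j) ∧ ∀ k ∈ S, k < j → v k < v j

lemma exists_isFirstMax {D : ℕ} {S : Finset (Fin D)} (hS : S.Nonempty) (v : Fin D → ℝ) :
    ∃ j, IsFirstMax S v j := by
  classical
  obtain ⟨j₀, hj₀, hmax⟩ := S.exists_max_image v hS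
  have hne : (S.filter fun j => ∀ k ∈ S, v k ≤ v j).Nonempty :=
    ⟨j₀, Finset.mem_filter.2 ⟨hj₀, hmax⟩⟩
  have hmem := Finset.mem_filter.1 (Finset.min'_mem _ hne)
  refine ⟨_, hmem.1, hmem.2, fun k hk hlt => ?_⟩
  by_contra! hge
  exact absurd (Finset.min'_le _ k (Finset.mem_filter.2
    ⟨hk, fun l hl => (hmem.2 l hl).trans hge⟩)) (not_le.2 hlt)

lemma IsFirstMax.unique {D : ℕ} {S : Finset (Fin D)} {v : Fin D → ℝ} {j j' : Fin D}
    (h : IsFirstMax S v j) (h' : IsFirstMax S v j') : j = j' := by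
  rcases lt_trichotomy j j' with hlt | heq | hlt
  · exact absurd (h'.2.2 j h.1 hlt) (not_lt.2 (h.2.1 j' h'.1))
  · exact heq
  · exact absurd (h.2.2 j' h'.1 hlt) (not_lt.2 (h'.2.1 j h.1))

section Block

variable {D : ℕ} (p : Fin D → Profile) (S : Finset (Fin D)) (L : ℝ≥0) (ρ : ℝ)
  (x₀ : EuclideanSpace ℝ (Fin D))

/-- The value of the `j`-th profile at the `j`-th coordinate of `x`, in units of `ρ` and
relative to `x₀`. -/
noncomputable def profileVal (x : EuclideanSpace ℝ (Fin D)) (j : Fin D) : ℝ :=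
  (p j).val ((x j - x₀ j) / ρ)

/-- The maximum over `j ∈ S` of the profiles, rescaled to be `L`-Lipschitz; it is `0` if `S` is
empty. -/
noncomputable def blockMax (x : EuclideanSpace ℝ (Fin D)) : ℝ :=
  L * ρ * S.fold max 0 (profileVal p ρ x₀ x)

open Classical in
/-- The subgradient of `blockMax` that is taken from the first coordinate whose profile attains
the maximum. -/
noncomputable def blockSubgradient (x : EuclideanSpace ℝ (Fin D)) : EuclideanSpace ℝ (Fin D) :=
  if h : ∃ j, IsFirstMax S (profileVal p ρ x₀ x) j then
    EuclideanSpace.single h.choose (L * (p h.choose).slope ((x h.choose - x₀ h.choose) / ρ))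
  else 0

/-- The point at which all the profiles of the coordinates in `U` are minimal. -/
noncomputable def blockArgmin (U : Finset (Fin D)) : EuclideanSpace ℝ (Fin D) :=
  WithLp.toLp 2 fun j => if j ∈ U then x₀ j + ρ * (p j).argmin else x₀ j

variable {p S L ρ x₀}

lemma blockMax_of_isFirstMax {x : EuclideanSpace ℝ (Fin D)} {j : Fin D}
    (h : IsFirstMax S (profileVal p ρ x₀ x) j) :
    blockMax p S L ρ x₀ x = L * ρ * profileVal p ρ x₀ x j := by
  rw [blockMax]
  congr 1
  exact le_antisymm (Finset.fold_max_le _ |>.2 ⟨(p j).val_nonneg _, h.2.1⟩)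
    (Finset.le_fold_max _ |>.2 (Or.inr ⟨j, h.1, le_rfl⟩))

lemma blockSubgradient_of_isFirstMax {x : EuclideanSpace ℝ (Fin D)} {j : Fin D}
    (h : IsFirstMax S (profileVal p ρ x₀ x) j) :
    blockSubgradient p S L ρ x₀ x =
      EuclideanSpace.single j (L * (p j).slope ((x j - x₀ j) / ρ)) := by
  have hex : ∃ j, IsFirstMax S (profileVal p ρ x₀ x) j := ⟨j, h⟩
  rw [blockSubgradient, dif_pos hex, hex.choose_spec.unique h]

lemma le_blockMax (hρ : 0 < ρ) {x : EuclideanSpace ℝ (Fin D)} {j : Fin D} (hj : j ∈ S) :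
    L * ρ * profileVal p ρ x₀ x j ≤ blockMax p S L ρ x₀ x :=
  mul_le_mul_of_nonneg_left (Finset.le_fold_max _ |>.2 (Or.inr ⟨j, hj, le_rfl⟩)) (by positivity)

lemma blockMax_nonneg (hρ : 0 < ρ) (x : EuclideanSpace ℝ (Fin D)) :
    0 ≤ blockMax p S L ρ x₀ x :=
  mul_nonneg (by positivity) (Finset.le_fold_max _ |>.2 (Or.inl le_rfl))

lemma isSubgradientAt_blockSubgradient (hρ : 0 < ρ) (x : EuclideanSpace ℝ (Fin D)) :
    IsSubgradientAt (blockMax p S L ρ x₀) (blockSubgradient p S L ρ x₀ x) x := by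
  intro y
  rcases S.eq_empty_or_nonempty with rfl | hS
  · have : ¬ ∃ j, IsFirstMax ∅ (profileVal p ρ x₀ x) j := by
      rintro ⟨j, hj, -⟩; simp at hj
    simp [blockMax, blockSubgradient, this]
  · obtain ⟨j, hj⟩ := exists_isFirstMax hS (profileVal p ρ x₀ x)
    rw [blockMax_of_isFirstMax hj, blockSubgradient_of_isFirstMax hj]
    refine le_trans (le_of_eq_of_le ?_ (mul_le_mul_of_nonneg_left
      ((p j).val_add_slope_mul_le ((x j - x₀ j) / ρ) ((y j - x₀ j) / ρ))
      (by positivity : (0 : ℝ) ≤ L * ρ))) (le_blockMax hρ hj.1)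
    simp only [profileVal, EuclideanSpace.inner_single_left, PiLp.sub_apply]
    simp
    field_simp
    ring

lemma norm_blockSubgradient_le (x : EuclideanSpace ℝ (Fin D)) :
    ‖blockSubgradient p S L ρ x₀ x‖ ≤ L := by
  rw [blockSubgradient]
  split_ifs with h
  · rw [PiLp.norm_single, norm_mul, NNReal.norm_eq, Real.norm_eq_abs]
    exact mul_le_of_le_one_right L.2 ((p _).abs_slope_le _)
  · simp

lemma profileVal_blockArgmin (hρ : 0 < ρ) {U : Finset (Fin D)} {j : Fin D} (hj : j ∈ U) :
    profileVal p ρ x₀ (blockArgmin p ρ x₀ U) j = 0 := by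
  rw [profileVal, ← (p j).val_argmin]
  congr 1
  simp [blockArgmin, hj, hρ.ne']

lemma blockMax_blockArgmin (hρ : 0 < ρ) {U : Finset (Fin D)} (hSU : S ⊆ U) :
    blockMax p S L ρ x₀ (blockArgmin p ρ x₀ U) = 0 := by
  rw [blockMax, le_antisymm (Finset.fold_max_le _ |>.2
    ⟨le_rfl, fun j hj => (profileVal_blockArgmin hρ (hSU hj)).le⟩)
    (Finset.le_fold_max _ |>.2 (Or.inl le_rfl)), mul_zero]

lemma norm_sub_blockArgmin_le (hρ : 0 < ρ) (U : Finset (Fin D)) :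
    ‖x₀ - blockArgmin p ρ x₀ U‖ ≤ ρ * √U.card := by
  rw [EuclideanSpace.norm_eq]
  refine Real.sqrt_le_iff.2 ⟨by positivity, ?_⟩
  have h : ∀ j, ‖(x₀ - blockArgmin p ρ x₀ U) j‖ ^ 2 ≤ if j ∈ U then ρ ^ 2 else 0 := fun j => by
    split_ifs with hj
    · have : (x₀ - blockArgmin p ρ x₀ U) j = -(ρ * (p j).argmin) := by simp [blockArgmin, hj]
      rw [this, norm_neg, norm_mul, mul_pow, Real.norm_of_nonneg hρ.le]
      exact mul_le_of_le_one_right (by positivity)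
        (pow_le_one₀ (norm_nonneg _) (p j).abs_argmin_le)
    · simp [blockArgmin, hj]
  refine (Finset.sum_le_sum fun j _ => h j).trans ?_
  rw [mul_pow, Real.sq_sqrt (Nat.cast_nonneg _)]
  simp [mul_comm]

lemma dependsExactlyOn_blockMax (hL : 0 < L) (hρ : 0 < ρ) :
    DependsExactlyOn (blockMax p S L ρ x₀) S := by
  constructor
  · intro x y hxy
    rw [blockMax, blockMax]
    congr 1
    exact Finset.fold_congr fun j hj => by rw [profileVal, profileVal, hxy j hj]
  · intro j hj
    obtain ⟨w, hw⟩ := (p j).exists_val_ne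
    refine ⟨blockArgmin p ρ x₀ S,
      WithLp.toLp 2 (Function.update (blockArgmin p ρ x₀ S) j (x₀ j + ρ * w)),
      fun k hk => by simp [hk], ?_⟩
    rw [blockMax_blockArgmin hρ subset_rfl]
    refine (lt_of_lt_of_le ?_ (le_blockMax hρ hj)).ne
    have : 0 < (p j).val w := lt_of_le_of_ne ((p j).val_nonneg w) hw.symm
    have h2 : (x₀ j + ρ * w - x₀ j) / ρ = w := by field_simp; ring
    simp only [profileVal, Function.update_self, h2]
    positivity

end Block

lemma convexOn_of_isSubgradientAt {D : ℕ} {f : EuclideanSpace ℝ (Fin D) → ℝ}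
    {g : EuclideanSpace ℝ (Fin D) → EuclideanSpace ℝ (Fin D)}
    (h : ∀ x, IsSubgradientAt f (g x) x) : ConvexOn ℝ Set.univ f := by
  refine ⟨convex_univ, fun x _ y _ a b ha hb hab => ?_⟩
  have hx := mul_le_mul_of_nonneg_left (h (a • x + b • y) x) ha
  have hy := mul_le_mul_of_nonneg_left (h (a • x + b • y) y) hb
  have hz : a * inner ℝ (g (a • x + b • y)) (x - (a • x + b • y)) +
      b * inner ℝ (g (a • x + b • y)) (y - (a • x + b • y)) = 0 := by
    rw [← real_inner_smul_right, ← real_inner_smul_right, ← inner_add_right]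
    have : a • (x - (a • x + b • y)) + b • (y - (a • x + b • y)) = 0 := by
      obtain rfl : b = 1 - a := by linarith
      module
    rw [this, inner_zero_right]
  have hs : f (a • x + b • y) = a * f (a • x + b • y) + b * f (a • x + b • y) := by
    rw [← add_mul, hab, one_mul]
  simp only [smul_eq_mul]
  linarith

lemma lipschitzWith_of_isSubgradientAt {D : ℕ} {L : ℝ≥0} {f : EuclideanSpace ℝ (Fin D) → ℝ}
    {g : EuclideanSpace ℝ (Fin D) → EuclideanSpace ℝ (Fin D)}
    (h : ∀ x, IsSubgradientAt f (g x) x) (hg : ∀ x, ‖g x‖ ≤ L) : LipschitzWith L f := by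
  refine LipschitzWith.of_le_add_mul L fun x y => ?_
  have h1 := h x y
  have h2 : inner ℝ (g x) (x - y) ≤ L * dist x y := by
    rw [dist_eq_norm]
    exact (real_inner_le_norm _ _).trans (mul_le_mul_of_nonneg_right (hg x) (norm_nonneg _))
  rw [← neg_sub x y, inner_neg_right] at h1
  linarith

section Instance

variable {n D : ℕ} {S : Fin n → Finset (Fin D)} {L : ℝ≥0} {ρ R : ℝ}
  {x₀ : EuclideanSpace ℝ (Fin D)} (p : Fin D → Profile)

lemma isSubgradientOracle_block (hρ : 0 < ρ) :
    IsSubgradientOracle (fun i => blockMax p (S i) L ρ x₀)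
      (fun i => blockSubgradient p (S i) L ρ x₀) :=
  fun _ x => isSubgradientAt_blockSubgradient hρ x

lemma sum_blockMax_blockArgmin (hρ : 0 < ρ) :
    ∑ i, blockMax p (S i) L ρ x₀ (blockArgmin p ρ x₀ (Finset.univ.biUnion S)) = 0 :=
  Finset.sum_eq_zero fun i _ =>
    blockMax_blockArgmin hρ (Finset.subset_biUnion_of_mem S (Finset.mem_univ i))

lemma isDecomposableInstance_block (hL : 0 < L) (hρ : 0 < ρ)
    (hR : ρ * √(Finset.univ.biUnion S).card ≤ R) :
    IsDecomposableInstance S L R x₀ (fun i => blockMax p (S i) L ρ x₀)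
      (blockArgmin p ρ x₀ (Finset.univ.biUnion S)) where
  convex _ := convexOn_of_isSubgradientAt fun x => isSubgradientAt_blockSubgradient hρ x
  lipschitz _ := lipschitzWith_of_isSubgradientAt
    (fun x => isSubgradientAt_blockSubgradient hρ x) fun x => norm_blockSubgradient_le x
  dependsOn _ := dependsExactlyOn_blockMax hL hρ
  isMin x := by
    rw [sum_blockMax_blockArgmin p hρ]
    exact Finset.sum_nonneg fun i _ => blockMax_nonneg hρ x
  dist_le := (norm_sub_blockArgmin_le hρ _).trans hR

lemma le_sum_blockMax (hρ : 0 < ρ) (x : EuclideanSpace ℝ (Fin D)) {i : Fin n} {j : Fin D}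
    (hj : j ∈ S i) : L * ρ * profileVal p ρ x₀ x j ≤ ∑ i, blockMax p (S i) L ρ x₀ x :=
  (le_blockMax hρ hj).trans (Finset.single_le_sum (f := fun i => blockMax p (S i) L ρ x₀ x)
    (fun _ _ => blockMax_nonneg hρ x) (Finset.mem_univ i))

end Instance

/-! ### Algorithms against hidden bits -/

section Counting

variable {ι : Type*} [Fintype ι] [DecidableEq ι]

/-- The bit vectors that agree with `a` on the set `Q` of revealed positions. -/
def subcube (Q : Finset ι) (a : ι → Bool) : Finset (ι → Bool) :=
  Fintype.piFinset fun q => if q ∈ Q then {a q} else Finset.univ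

lemma mem_subcube {Q : Finset ι} {a b : ι → Bool} : b ∈ subcube Q a ↔ ∀ q ∈ Q, b q = a q := by
  rw [subcube, Fintype.mem_piFinset]
  refine forall_congr' fun q => ?_
  split_ifs with h <;> simp [h]

lemma card_subcube (Q : Finset ι) (a : ι → Bool) : (subcube Q a).card = 2 ^ Qᶜ.card := by
  have h : ∀ q, (if q ∈ Q then {a q} else Finset.univ : Finset Bool).card =
      if q ∈ Qᶜ then 2 else 1 := fun q => by
    by_cases hq : q ∈ Q <;> simp [hq]
  rw [subcube, Fintype.card_piFinset, Finset.prod_congr rfl fun q _ => h q, Finset.prod_ite_mem,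
    Finset.univ_inter, Finset.prod_const]

lemma mem_subcube_insert {Q : Finset ι} {q : ι} (hq : q ∉ Q) {a b : ι → Bool} {v : Bool} :
    b ∈ subcube (insert q Q) (Function.update a q v) ↔ b ∈ subcube Q a ∧ b q = v := by
  simp only [mem_subcube, Finset.forall_mem_insert, Function.update_self]
  rw [and_comm]
  refine and_congr_left fun _ => forall₂_congr fun r hr => ?_
  rw [Function.update_of_ne (ne_of_mem_of_not_mem hr hq)]

lemma card_filter_subcube {Q : Finset ι} {q : ι} (hq : q ∉ Q) (a : ι → Bool) (v : Bool)
    (P : (ι → Bool) → Prop) [DecidablePred P] :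
    ((subcube Q a).filter P).card =
      ((subcube (insert q Q) (Function.update a q v)).filter P).card +
        ((subcube (insert q Q) (Function.update a q !v)).filter P).card := by
  rw [← Finset.card_union_of_disjoint]
  · congr 1
    ext b
    simp only [Finset.mem_filter, Finset.mem_union, mem_subcube_insert hq]
    cases b q <;> cases v <;> simp
  · rw [Finset.disjoint_left]
    intro b h1 h2
    have h1 := ((mem_subcube_insert hq).1 (Finset.mem_filter.1 h1).1).2
    have h2 := ((mem_subcube_insert hq).1 (Finset.mem_filter.1 h2).1).2
    rw [h1] at h2
    simp at h2

/-- A bound for the number of instances, indexed by bit vectors, that an algorithm can solve with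
`T` queries. The hypothesis `hstep` says that the answer to a query can be found by revealing
hidden bits one at a time, such that each revealed bit has a value with which it settles the
answer; for random bits, a query thus reveals a number of bits that is dominated by a geometric
distribution. The hypothesis `hout` says that every point fails for at least half of the bit
vectors in a subcube, as long as some bit is hidden. The bound is chosen such that the two halves of
a subcube, with `T - 1` and `T` queries left, add up to it exactly. -/
theorem card_filter_success_le {n D : ℕ} {f : (ι → Bool) → Fin n → EuclideanSpace ℝ (Fin D) → ℝ}
    {g : (ι → Bool) → Fin n → EuclideanSpace ℝ (Fin D) → EuclideanSpace ℝ (Fin D)}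
    {good : Finset ι → Prop} {solves : (ι → Bool) → EuclideanSpace ℝ (Fin D) → Prop}
    (hstep : ∀ Q, good Q → ∀ a i x,
      (∀ b ∈ subcube Q a, ∀ b' ∈ subcube Q a, f b i x = f b' i x ∧ g b i x = g b' i x) ∨
      ∃ q ∉ Q, good (insert q Q) ∧ ∃ v, ∀ b ∈ subcube Q a, ∀ b' ∈ subcube Q a,
        b q = v → b' q = v → f b i x = f b' i x ∧ g b i x = g b' i x)
    (hout : ∀ Q, good Q → Q ≠ Finset.univ → ∀ a x,
      ∃ q ∉ Q, ∃ v, ∀ b ∈ subcube Q a, b q = v → ¬ solves b x)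
    (A : QueryAlgorithm n D) (T : ℕ) (Q : Finset ι) (hQ : good Q) (a : ι → Bool)
    [DecidablePred fun b => A.numQueries (f b) (g b) ≤ T ∧ solves b (A.result (f b) (g b))] :
    (((subcube Q a).filter fun b => A.numQueries (f b) (g b) ≤ T ∧
      solves b (A.result (f b) (g b))).card : ℝ) ≤
      2 ^ Qᶜ.card * (1 / 2 + 2 ^ T * (3 / 4) ^ Qᶜ.card) := by
  classical
  rw [Finset.filter_congr_decidable]
  have hcompl : ∀ (Q : Finset ι) (q : ι), q ∉ Q → Qᶜ.card = (insert q Q)ᶜ.card + 1 := by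
    intro Q q hq
    have h1 := Finset.card_compl_add_card Q
    have h2 := Finset.card_compl_add_card (insert q Q)
    rw [Finset.card_insert_of_notMem hq] at h2
    omega
  induction A generalizing T Q a with
  | output x =>
    have hT : (1 : ℝ) ≤ 2 ^ T := one_le_pow₀ (by norm_num)
    by_cases hu : Q = Finset.univ
    · have h := Finset.card_filter_le (subcube Q a) fun b =>
        (QueryAlgorithm.output (n := n) x).numQueries (f b) (g b) ≤ T ∧
          solves b ((QueryAlgorithm.output (n := n) x).result (f b) (g b))
      rw [card_subcube] at h
      subst hu
      simp only [Finset.compl_univ, Finset.card_empty, pow_zero] at h ⊢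
      have h' := Nat.cast_le (α := ℝ).2 h
      push_cast at h'
      linarith
    · obtain ⟨q, hq, v, hv⟩ := hout Q hQ hu a x
      rw [card_filter_subcube hq a v, Finset.card_eq_zero.2, zero_add]
      · refine (Nat.cast_le.2 (Finset.card_filter_le _ _)).trans ?_
        rw [card_subcube, hcompl Q q hq, pow_succ]
        push_cast
        rw [mul_assoc]
        refine le_mul_of_one_le_right (by positivity) ?_
        have : (0 : ℝ) ≤ 2 ^ T * (3 / 4) ^ ((insert q Q)ᶜ.card + 1) := by positivity
        linarith
      · rw [Finset.filter_eq_empty_iff]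
        intro b hb
        obtain ⟨hb, hbq⟩ := (mem_subcube_insert hq).1 hb
        exact fun h => hv b hb hbq h.2
  | query i x next ih =>
    rcases T with _ | T
    · rw [Finset.filter_false_of_mem]
      · simp only [Finset.card_empty, Nat.cast_zero]
        positivity
      · intro b _ h
        exact absurd h.1 (by simp [QueryAlgorithm.numQueries])
    -- once the answer is settled, the algorithm continues with one query less
    have hsettled : ∀ Q, good Q → ∀ a, (∀ b ∈ subcube Q a, ∀ b' ∈ subcube Q a,
        f b i x = f b' i x ∧ g b i x = g b' i x) →
        (((subcube Q a).filter fun b =>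
          (QueryAlgorithm.query i x next).numQueries (f b) (g b) ≤ T + 1 ∧
          solves b ((QueryAlgorithm.query i x next).result (f b) (g b))).card : ℝ) ≤
        2 ^ Qᶜ.card * (1 / 2 + 2 ^ T * (3 / 4) ^ Qᶜ.card) := by
      intro Q hQ a hsame
      refine le_trans ?_ (ih (f a i x) (g a i x) T Q hQ a)
      rw [Nat.cast_le]
      refine Finset.card_le_card fun b hb => ?_
      obtain ⟨hb, h1, h2⟩ := Finset.mem_filter.1 hb
      obtain ⟨hf, hg⟩ := hsame b hb a (mem_subcube.2 fun _ _ => rfl)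
      rw [QueryAlgorithm.numQueries, hf, hg] at h1
      rw [QueryAlgorithm.result, hf, hg] at h2
      exact Finset.mem_filter.2 ⟨hb, by omega, h2⟩
    induction hu : Qᶜ.card generalizing Q a with
    | zero =>
      rcases hstep Q hQ a i x with hsame | ⟨q, hq, -⟩
      · refine (hsettled Q hQ a hsame).trans ?_
        rw [hu, pow_succ 2 T]
        have : (0 : ℝ) < 2 ^ T := by positivity
        linarith
      · have := hcompl Q q hq
        omega
    | succ u ihu =>
      rcases hstep Q hQ a i x with hsame | ⟨q, hq, hgood, v, hv⟩
      · refine (hsettled Q hQ a hsame).trans ?_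
        rw [hu, pow_succ 2 T]
        gcongr
        linarith [show (0 : ℝ) < 2 ^ T by positivity]
      · have hu' : (insert q Q)ᶜ.card = u := by have := hcompl Q q hq; omega
        rw [card_filter_subcube hq a v]
        push_cast
        have h1 := hsettled (insert q Q) hgood (Function.update a q v) fun b hb b' hb' => by
          rw [mem_subcube_insert hq] at hb hb'
          exact hv b hb.1 b' hb'.1 hb.2 hb'.2
        have h2 := ihu (insert q Q) hgood (Function.update a q !v) hu'
        rw [hu'] at h1
        refine (add_le_add h1 h2).trans (le_of_eq ?_)
        ring

end Counting

/-- If each outcome lies in at least the fraction `p` of finitely many events, then one of the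
events has outer measure at least `p`; the events need not be measurable. -/
lemma exists_le_measure_of_forall_card {Ω β : Type*} [MeasurableSpace Ω]
    (μ : MeasureTheory.Measure Ω) [MeasureTheory.IsProbabilityMeasure μ] {s : Finset β}
    (hs : s.Nonempty) (F : β → Set Ω) [∀ ω, DecidablePred fun b => ω ∈ F b] (p : ℝ≥0∞)
    (h : ∀ ω, p * s.card ≤ ((s.filter fun b => ω ∈ F b).card : ℝ≥0∞)) :
    ∃ b ∈ s, p ≤ μ (F b) := by
  by_contra! hlt
  refine absurd (ENNReal.sum_lt_sum_of_nonempty hs hlt) (not_lt.2 ?_)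
  calc ∑ _b ∈ s, p = ∫⁻ _ω, p * s.card ∂μ := by simp [mul_comm]
    _ ≤ ∫⁻ ω, ∑ b ∈ s, (MeasureTheory.toMeasurable μ (F b)).indicator 1 ω ∂μ := by
      refine MeasureTheory.lintegral_mono fun ω => (h ω).trans ?_
      rw [Finset.card_filter]
      push_cast
      refine Finset.sum_le_sum fun b _ => ?_
      split_ifs with hb
      · rw [Set.indicator_of_mem (MeasureTheory.subset_toMeasurable μ _ hb)]
        simp
      · simp
    _ = ∑ b ∈ s, μ (F b) := by
      rw [MeasureTheory.lintegral_finsetSum _ fun b _ =>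
        measurable_one.indicator (MeasureTheory.measurableSet_toMeasurable _ _)]
      refine Finset.sum_congr rfl fun b _ => ?_
      rw [MeasureTheory.lintegral_indicator_one (MeasureTheory.measurableSet_toMeasurable _ _),
        MeasureTheory.measure_toMeasurable]

/-! ### The hard family -/

section HardFamily

variable {D K : ℕ}

/-- The bits of `b` that steer coordinate `j`. -/
def bits (b : Fin D × Fin K → Bool) (j : Fin D) (k : ℕ) : Bool :=
  if h : k < K then b (j, ⟨k, h⟩) else false

/-- The hard functions with the bits `b`. -/
noncomputable def hardProfile (b : Fin D × Fin K → Bool) (j : Fin D) : Profile :=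
  nestProfile K (bits b j)

/-- For every coordinate, the positions in `Q` are the first ones. -/
def IsInitial (Q : Finset (Fin D × Fin K)) : Prop :=
  ∃ ℓ : Fin D → ℕ, ∀ j k, (j, k) ∈ Q ↔ (k : ℕ) < ℓ j

lemma bits_eq_of_mem_subcube {Q : Finset (Fin D × Fin K)} {ℓ : Fin D → ℕ}
    (hℓ : ∀ j k, (j, k) ∈ Q ↔ (k : ℕ) < ℓ j) {a b : Fin D × Fin K → Bool}
    (hb : b ∈ subcube Q a) {j : Fin D} {k : ℕ} (hk : k < ℓ j) : bits b j k = bits a j k := by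
  unfold bits
  split_ifs with h
  · exact mem_subcube.1 hb _ ((hℓ j ⟨k, h⟩).2 hk)
  · rfl

/-- To answer a query, reveal the next hidden bit of the coordinate with the largest upper bound
for the value of its profile; with probability `1/2` the upper bound is attained, and then that
coordinate determines the answer. -/
lemma exists_bit_settles_block (S : Finset (Fin D)) (L : ℝ≥0) (ρ : ℝ)
    (x₀ : EuclideanSpace ℝ (Fin D)) {Q : Finset (Fin D × Fin K)} (hQ : IsInitial Q)
    (a : Fin D × Fin K → Bool) (x : EuclideanSpace ℝ (Fin D)) :
    (∀ b ∈ subcube Q a, ∀ b' ∈ subcube Q a,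
      blockMax (hardProfile b) S L ρ x₀ x = blockMax (hardProfile b') S L ρ x₀ x ∧
      blockSubgradient (hardProfile b) S L ρ x₀ x =
        blockSubgradient (hardProfile b') S L ρ x₀ x) ∨
    ∃ q ∉ Q, IsInitial (insert q Q) ∧ ∃ v, ∀ b ∈ subcube Q a, ∀ b' ∈ subcube Q a,
      b q = v → b' q = v →
      blockMax (hardProfile b) S L ρ x₀ x = blockMax (hardProfile b') S L ρ x₀ x ∧
      blockSubgradient (hardProfile b) S L ρ x₀ x =
        blockSubgradient (hardProfile b') S L ρ x₀ x := by
  classical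
  rcases S.eq_empty_or_nonempty with rfl | hS
  · have : ∀ v : Fin D → ℝ, ¬ ∃ j, IsFirstMax ∅ v j := by
      rintro v ⟨j, hj, -⟩; simp at hj
    exact Or.inl fun b _ b' _ => by simp [blockMax, blockSubgradient, this]
  obtain ⟨ℓ, hℓ⟩ := hQ
  choose v hv using fun j => exists_wrongSide (ℓ j) (bits a j) ((x j - x₀ j) / ρ)
  set β : Fin D → ℕ → Bool := fun j => Function.update (bits a j) (ℓ j) (v j) with hβ
  have hlow : ∀ b ∈ subcube Q a, ∀ j, ∀ l < ℓ j, bits b j l = β j l := fun b hb j l hl => by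
    rw [bits_eq_of_mem_subcube hℓ hb hl]
    exact (Function.update_of_ne hl.ne _ _).symm
  have hle : ∀ b ∈ subcube Q a, ∀ j,
      profileVal (hardProfile b) ρ x₀ x j ≤ profileVal (fun j => nestProfile K (β j)) ρ x₀ x j := by
    intro b hb j
    refine sub_le_sub_right ?_ _
    by_cases hj : ℓ j < K
    · exact nest_le_of_wrongSide hj (hv j) (hlow b hb j)
    · exact (nest_congr (fun l hl => hlow b hb j l (by omega)) _).le
  obtain ⟨j, hj⟩ := exists_isFirstMax hS (profileVal (fun j => nestProfile K (β j)) ρ x₀ x)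
  -- if the upper bound of the first maximizing coordinate is attained, the answer is determined
  have hfirst : ∀ b ∈ subcube Q a,
      nest K (bits b j) ((x j - x₀ j) / ρ) = nest K (β j) ((x j - x₀ j) / ρ) →
      IsFirstMax S (profileVal (hardProfile b) ρ x₀ x) j := by
    intro b hb heq
    have heq' : profileVal (hardProfile b) ρ x₀ x j =
        profileVal (fun j => nestProfile K (β j)) ρ x₀ x j :=
      congrArg (· - nestMin K) heq
    refine ⟨hj.1, fun k hk => ?_, fun k hk hkj => ?_⟩
    · rw [heq']; exact (hle b hb k).trans (hj.2.1 k hk)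
    · rw [heq']; exact (hle b hb k).trans_lt (hj.2.2 k hk hkj)
  have hans : ∀ b ∈ subcube Q a, ∀ b' ∈ subcube Q a,
      nest K (bits b j) ((x j - x₀ j) / ρ) = nest K (β j) ((x j - x₀ j) / ρ) →
      nest K (bits b' j) ((x j - x₀ j) / ρ) = nest K (β j) ((x j - x₀ j) / ρ) →
      nestSlope K (bits b j) ((x j - x₀ j) / ρ) = nestSlope K (bits b' j) ((x j - x₀ j) / ρ) →
      blockMax (hardProfile b) S L ρ x₀ x = blockMax (hardProfile b') S L ρ x₀ x ∧
      blockSubgradient (hardProfile b) S L ρ x₀ x =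
        blockSubgradient (hardProfile b') S L ρ x₀ x := by
    intro b hb b' hb' h h' hs
    rw [blockMax_of_isFirstMax (hfirst b hb h), blockMax_of_isFirstMax (hfirst b' hb' h'),
      blockSubgradient_of_isFirstMax (hfirst b hb h),
      blockSubgradient_of_isFirstMax (hfirst b' hb' h')]
    simp only [profileVal, hardProfile, nestProfile, h, h', hs, and_self]
  by_cases hK : ℓ j < K
  · right
    refine ⟨(j, ⟨ℓ j, hK⟩), by simp [hℓ], ⟨Function.update ℓ j (ℓ j + 1), fun j' k => ?_⟩, v j, ?_⟩
    · by_cases hjj : j' = j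
      · subst hjj
        simp only [Finset.mem_insert, hℓ, Prod.mk.injEq, true_and, Function.update_self, Fin.ext_iff]
        omega
      · simp [hjj, hℓ]
    · have hbit : ∀ b ∈ subcube Q a, b (j, ⟨ℓ j, hK⟩) = v j → ∀ l ≤ ℓ j, bits b j l = β j l := by
        intro b hb hbv l hl
        rcases hl.lt_or_eq with hl | rfl
        · exact hlow b hb j l hl
        · simp only [bits, hK, dif_pos, hbv, hβ, Function.update_self]
      intro b hb b' hb' h h'
      refine hans b hb b' hb' (nest_eq_of_wrongSide hK (hv j) (hbit b hb h))
        (nest_eq_of_wrongSide hK (hv j) (hbit b' hb' h')) ?_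
      rw [nestSlope_eq_of_wrongSide hK (hv j) (hbit b hb h),
        nestSlope_eq_of_wrongSide hK (hv j) (hbit b' hb' h')]
  · left
    have hall : ∀ b ∈ subcube Q a, bits b j = bits a j := fun b hb => by
      funext l
      by_cases hl : l < K
      · exact bits_eq_of_mem_subcube hℓ hb (by omega)
      · simp [bits, hl]
    have hval : ∀ b ∈ subcube Q a,
        nest K (bits b j) ((x j - x₀ j) / ρ) = nest K (β j) ((x j - x₀ j) / ρ) :=
      fun b hb => nest_congr (fun l hl => hlow b hb j l (by omega)) _
    intro b hb b' hb'
    exact hans b hb b' hb' (hval b hb) (hval b' hb') (by rw [hall b hb, hall b' hb'])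

end HardFamily

/-! ### Hard instances -/

section LowerBound

variable {n D : ℕ} {S : Fin n → Finset (Fin D)} {L : ℝ≥0} {R ε : ℝ}
  {x₀ : EuclideanSpace ℝ (Fin D)}

/-- A point that solves the instance with the bits `b` has to be on the right side at each level
of each coordinate. -/
lemma exists_bit_not_solves {K : ℕ} {ρ : ℝ} (hL : 0 < L) (hρ : 0 < ρ)
    (hε : ε * R < (1 / 8) ^ K * ρ) {Q : Finset (Fin D × Fin K)} (hQ : IsInitial Q)
    (hQS : ∀ j ∉ Finset.univ.biUnion S, ∀ k, (j, k) ∈ Q) (hne : Q ≠ Finset.univ)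
    (a : Fin D × Fin K → Bool) (x : EuclideanSpace ℝ (Fin D)) :
    ∃ q ∉ Q, ∃ v, ∀ b ∈ subcube Q a, b q = v →
      ¬ ∑ i, blockMax (hardProfile b) (S i) L ρ x₀ x ≤ ε * L * R := by
  obtain ⟨ℓ, hℓ⟩ := hQ
  obtain ⟨⟨j, k⟩, hjk⟩ : ∃ q, q ∉ Q := by
    by_contra! h
    exact hne (Finset.eq_univ_iff_forall.2 h)
  have hK : ℓ j < K := lt_of_le_of_lt (not_lt.1 ((hℓ j k).not.1 hjk)) k.2
  obtain ⟨i, hi⟩ : ∃ i, j ∈ S i := by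
    by_contra! h
    exact hjk (hQS j (by simpa using h) k)
  obtain ⟨v, hv⟩ := exists_wrongSide (ℓ j) (bits a j) ((x j - x₀ j) / ρ)
  refine ⟨(j, ⟨ℓ j, hK⟩), by simp [hℓ], v, fun b hb hbv => not_le.2 ?_⟩
  have hw : WrongSide (ℓ j) (bits b j) ((x j - x₀ j) / ρ) := by
    refine hv.congr fun l hl => ?_
    rcases hl.lt_or_eq with hl | rfl
    · rw [bits_eq_of_mem_subcube hℓ hb hl, Function.update_of_ne hl.ne]
    · simp only [bits, hK, dif_pos, hbv, Function.update_self]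
  have hL' : (0 : ℝ) < L := hL
  calc ε * L * R = L * (ε * R) := by ring
    _ < L * ((1 / 8) ^ K * ρ) := mul_lt_mul_of_pos_left hε hL'
    _ = L * ρ * (1 / 8) ^ K := by ring
    _ ≤ L * ρ * profileVal (hardProfile b) ρ x₀ x j :=
      mul_le_mul_of_nonneg_left (pow_le_nest_sub_of_wrongSide hK hw) (by positivity)
    _ ≤ _ := le_sum_blockMax _ hρ x hi

/-- The lower bound for hard functions of depth `K`, with one bit per coordinate and level. -/
lemma exists_hard_instance {K T m : ℕ} (hm : m = (Finset.univ.biUnion S).card) (hL : 0 < L)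
    (hR : 0 < R) (hm0 : 0 < m) (hε : ε * √m < (1 / 8) ^ K)
    (hT : (2 : ℝ) ^ T * (3 / 4) ^ (m * K) ≤ 1 / 7) {Ω : Type*} [MeasurableSpace Ω]
    (μ : MeasureTheory.Measure Ω) [MeasureTheory.IsProbabilityMeasure μ]
    (A : Ω → QueryAlgorithm n D) :
    ∃ (f : Fin n → EuclideanSpace ℝ (Fin D) → ℝ)
      (g : Fin n → EuclideanSpace ℝ (Fin D) → EuclideanSpace ℝ (Fin D))
      (xopt : EuclideanSpace ℝ (Fin D)),
      IsDecomposableInstance S L R x₀ f xopt ∧ IsSubgradientOracle f g ∧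
      1 / 3 < μ {ω | ¬ ((A ω).numQueries f g ≤ T ∧
        ∑ i, f i ((A ω).result f g) ≤ ε * L * R + ∑ i, f i xopt)} := by
  classical
  set U := Finset.univ.biUnion S
  have hs : 0 < √(m : ℝ) := Real.sqrt_pos.2 (Nat.cast_pos.2 hm0)
  set ρ := R / √m with hρdef
  have hρ : 0 < ρ := div_pos hR hs
  have hρR : ρ * √U.card ≤ R := by rw [← hm, hρdef, div_mul_cancel₀ _ hs.ne']
  have hερ : ε * R < (1 / 8) ^ K * ρ := by
    rw [hρdef, mul_div_assoc', lt_div_iff₀ hs]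
    linarith [mul_lt_mul_of_pos_right hε hR]
  set f : (Fin D × Fin K → Bool) → Fin n → EuclideanSpace ℝ (Fin D) → ℝ :=
    fun b i => blockMax (hardProfile b) (S i) L ρ x₀
  set g : (Fin D × Fin K → Bool) → Fin n → EuclideanSpace ℝ (Fin D) →
      EuclideanSpace ℝ (Fin D) := fun b i => blockSubgradient (hardProfile b) (S i) L ρ x₀
  -- only the bits of the coordinates in the blocks are hidden
  set Q₀ : Finset (Fin D × Fin K) := Uᶜ ×ˢ Finset.univ with hQ₀
  have hQ₀card : Q₀ᶜ.card = m * K := by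
    have : Q₀ᶜ = U ×ˢ Finset.univ := by ext ⟨j, k⟩; simp [hQ₀]
    rw [this, Finset.card_product, Finset.card_univ, Fintype.card_fin, hm]
  have hgood : IsInitial Q₀ ∧ ∀ j ∉ U, ∀ k, (j, k) ∈ Q₀ := by
    refine ⟨⟨fun j => if j ∈ U then 0 else K, fun j k => ?_⟩, fun j hj k => by simp [hQ₀, hj]⟩
    by_cases hj : j ∈ U <;> simp [hQ₀, hj]
  have hcount : ∀ ω, (((subcube Q₀ fun _ => false).filter fun b =>
      (A ω).numQueries (f b) (g b) ≤ T ∧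
        ∑ i, f b i ((A ω).result (f b) (g b)) ≤ ε * L * R).card : ℝ) ≤
      2 ^ Q₀ᶜ.card * (1 / 2 + 2 ^ T * (3 / 4) ^ Q₀ᶜ.card) := by
    intro ω
    refine card_filter_success_le (f := f) (g := g)
      (good := fun Q => IsInitial Q ∧ ∀ j ∉ U, ∀ k, (j, k) ∈ Q)
      (solves := fun b x => ∑ i, f b i x ≤ ε * L * R) ?_ ?_ (A ω) T Q₀ hgood _
    · intro Q hQ a i x
      rcases exists_bit_settles_block (S i) L ρ x₀ hQ.1 a x with h | ⟨q, hq, hI, h⟩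
      · exact Or.inl h
      · exact Or.inr ⟨q, hq, ⟨hI, fun j hj k => Finset.mem_insert_of_mem (hQ.2 j hj k)⟩, h⟩
    · intro Q hQ hne a x
      exact exists_bit_not_solves hL hρ hερ hQ.1 hQ.2 hne a x
  obtain ⟨b, -, hb⟩ := exists_le_measure_of_forall_card μ
    (s := subcube Q₀ fun _ => false) ⟨_, mem_subcube.2 fun _ _ => rfl⟩
    (fun b => {ω | ¬ ((A ω).numQueries (f b) (g b) ≤ T ∧
      ∑ i, f b i ((A ω).result (f b) (g b)) ≤ ε * L * R)}) (ENNReal.ofReal (5 / 14)) (by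
      intro ω
      have h1 := hcount ω
      have h2 := Finset.card_filter_add_card_filter_not (s := subcube Q₀ fun _ => false)
        fun b => (A ω).numQueries (f b) (g b) ≤ T ∧
          ∑ i, f b i ((A ω).result (f b) (g b)) ≤ ε * L * R
      rw [← ENNReal.ofReal_natCast, ← ENNReal.ofReal_natCast,
        ← ENNReal.ofReal_mul (by norm_num)]
      refine ENNReal.ofReal_le_ofReal ?_
      simp only [Set.mem_ofPred_eq]
      have h3 : (0 : ℝ) < 2 ^ Q₀ᶜ.card := by positivity
      have h4 := congrArg (Nat.cast (R := ℝ)) h2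
      rw [card_subcube] at h4 ⊢
      push_cast at h4 ⊢
      rw [hQ₀card] at h1 h3 h4 ⊢
      have h5 := mul_le_mul_of_nonneg_left hT h3.le
      linarith)
  refine ⟨f b, g b, blockArgmin (hardProfile b) ρ x₀ U,
    isDecomposableInstance_block _ hL hρ hρR, isSubgradientOracle_block _ hρ, ?_⟩
  rw [sum_blockMax_blockArgmin _ hρ, add_zero]
  refine lt_of_lt_of_le ?_ hb
  rw [show (1 / 3 : ℝ≥0∞) = ENNReal.ofReal (1 / 3) by
    rw [ENNReal.ofReal_div_of_pos (by norm_num)]; simp]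
  exact (ENNReal.ofReal_lt_ofReal_iff (by norm_num)).2 (by norm_num)

/-- Without queries an algorithm cannot tell apart two instances whose minimizers are at distance
`2 * R`. This covers accuracies `ε` close to `1`. -/
lemma exists_hard_instance_of_zero_queries {m : ℕ} (hm : m = (Finset.univ.biUnion S).card)
    (hL : 0 < L) (hR : 0 < R) (hm0 : 0 < m) (hε : ε * √m < 1) {Ω : Type*} [MeasurableSpace Ω]
    (μ : MeasureTheory.Measure Ω) [MeasureTheory.IsProbabilityMeasure μ]
    (A : Ω → QueryAlgorithm n D) :
    ∃ (f : Fin n → EuclideanSpace ℝ (Fin D) → ℝ)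
      (g : Fin n → EuclideanSpace ℝ (Fin D) → EuclideanSpace ℝ (Fin D))
      (xopt : EuclideanSpace ℝ (Fin D)),
      IsDecomposableInstance S L R x₀ f xopt ∧ IsSubgradientOracle f g ∧
      1 / 3 < μ {ω | ¬ ((A ω).numQueries f g ≤ 0 ∧
        ∑ i, f i ((A ω).result f g) ≤ ε * L * R + ∑ i, f i xopt)} := by
  classical
  set U := Finset.univ.biUnion S with hU
  have hs : 0 < √(m : ℝ) := Real.sqrt_pos.2 (Nat.cast_pos.2 hm0)
  set ρ := R / √m with hρdef
  have hρ : 0 < ρ := div_pos hR hs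
  have hρR : ρ * √U.card ≤ R := by rw [← hm, hρdef, div_mul_cancel₀ _ hs.ne']
  have hερ : ε * R < ρ := by
    rw [hρdef, lt_div_iff₀ hs]
    linarith [mul_lt_mul_of_pos_right hε hR]
  have hL' : (0 : ℝ) < L := hL
  obtain ⟨j, hj⟩ : U.Nonempty := Finset.card_pos.1 (hm ▸ hm0)
  obtain ⟨i, -, hi⟩ := Finset.mem_biUnion.1 hj
  set f : Bool → Fin n → EuclideanSpace ℝ (Fin D) → ℝ :=
    fun v i => blockMax (fun _ => absProfile v) (S i) L ρ x₀
  set g : Bool → Fin n → EuclideanSpace ℝ (Fin D) →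
      EuclideanSpace ℝ (Fin D) := fun v i => blockSubgradient (fun _ => absProfile v) (S i) L ρ x₀
  have hfail : ∀ ω, ∃ v, ¬ ((A ω).numQueries (f v) (g v) ≤ 0 ∧
      ∑ i, f v i ((A ω).result (f v) (g v)) ≤ ε * L * R) := by
    intro ω
    rcases A ω with x | ⟨i', x, next⟩
    · by_contra! h
      have hclose : ∀ v, |(x j - x₀ j) / ρ - bitSign v| < 1 := fun v => by
        have h1 := (le_sum_blockMax (L := L) (x₀ := x₀) (fun _ => absProfile v) hρ x hi).trans
          (h v).2
        have h2 : L * ρ * |(x j - x₀ j) / ρ - bitSign v| < L * ρ * 1 := by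
          refine lt_of_le_of_lt h1 ?_
          linarith [mul_lt_mul_of_pos_left hερ hL']
        exact lt_of_mul_lt_mul_left h2 (by positivity)
      have h1 := abs_lt.1 (hclose true)
      have h2 := abs_lt.1 (hclose false)
      norm_num [bitSign] at h1 h2
      linarith
    · exact ⟨true, fun h => absurd h.1 (by simp [QueryAlgorithm.numQueries])⟩
  obtain ⟨v, -, hv⟩ := exists_le_measure_of_forall_card μ
    (s := (Finset.univ : Finset Bool)) Finset.univ_nonempty
    (fun v => {ω | ¬ ((A ω).numQueries (f v) (g v) ≤ 0 ∧
      ∑ i, f v i ((A ω).result (f v) (g v)) ≤ ε * L * R)}) (1 / 2) (by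
      intro ω
      obtain ⟨v, hv⟩ := hfail ω
      rw [Finset.card_univ, Fintype.card_bool, Nat.cast_ofNat,
        ENNReal.div_mul_cancel (by norm_num) (by norm_num), Nat.one_le_cast,
        Nat.one_le_iff_ne_zero, ← Nat.pos_iff_ne_zero, Finset.card_pos]
      exact ⟨v, Finset.mem_filter.2 ⟨Finset.mem_univ _, hv⟩⟩)
  refine ⟨f v, g v, blockArgmin (fun _ => absProfile v) ρ x₀ U,
    isDecomposableInstance_block _ hL hρ hρR, isSubgradientOracle_block _ hρ, ?_⟩
  rw [sum_blockMax_blockArgmin _ hρ, add_zero]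
  refine lt_of_lt_of_le ?_ hv
  rw [one_div, one_div, ENNReal.inv_lt_inv]
  norm_num

end LowerBound

/-! ### The choice of the depth -/

/-- The condition `α > 1 / 2` leaves a power of `ε` for the accuracy per coordinate. -/
lemma mul_sqrt_le_rpow {α ε : ℝ} {m : ℕ} (hα : 1 / 2 < α) (hm : 0 < m) (hε : 0 < ε)
    (h : ε ≤ (m : ℝ) ^ (-α)) : ε * √m ≤ ε ^ (1 - 1 / (2 * α)) := by
  have hm' : (0 : ℝ) < m := Nat.cast_pos.2 hm
  have h1 : √(m : ℝ) ≤ ε ^ (-(1 / (2 * α))) := by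
    have h2 := Real.rpow_le_rpow_of_nonpos hε h
      (show -(1 / (2 * α)) ≤ 0 by rw [neg_nonpos]; positivity)
    rwa [← Real.rpow_mul hm'.le, show -α * -(1 / (2 * α)) = 1 / 2 by field_simp,
      ← Real.sqrt_eq_rpow] at h2
  rw [sub_eq_add_neg, Real.rpow_add hε, Real.rpow_one]
  exact mul_le_mul_of_nonneg_left h1 hε.le

/-- If at least one query is allowed, there is a depth for which the accuracy is too demanding and
the number of hidden bits is at least `12` times the number of queries. -/
lemma exists_depth {α ε : ℝ} {m T : ℕ} (hα : 1 / 2 < α) (hm : 0 < m) (hε : 0 < ε)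
    (h : ε ≤ (m : ℝ) ^ (-α)) (hT : 1 ≤ T)
    (hTlt : (T : ℝ) < (1 - 1 / (2 * α)) / 72 * Real.exp (-(12 / (1 - 1 / (2 * α)))) * m *
      Real.log (1 / ε)) :
    ∃ K : ℕ, ε * √m < (1 / 8) ^ K ∧ 12 * T ≤ m * K := by
  set κ := 1 - 1 / (2 * α) with hκdef
  set Λ := Real.log (1 / ε) with hΛ
  have hκ : 0 < κ := by
    rw [hκdef, sub_pos, div_lt_one (by linarith)]; linarith
  have hm' : (0 : ℝ) < m := Nat.cast_pos.2 hm
  have hlogε : Real.log ε = -Λ := by rw [hΛ, one_div, Real.log_inv, neg_neg]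
  have hT' : (1 : ℝ) ≤ T := by exact_mod_cast hT
  have hexp : Real.exp (-(12 / κ)) ≤ 1 := Real.exp_le_one_iff.2 (by rw [neg_nonpos]; positivity)
  have hΛpos : 0 < Λ := by
    by_contra! hneg
    have : κ / 72 * Real.exp (-(12 / κ)) * m * Λ ≤ 0 :=
      mul_nonpos_of_nonneg_of_nonpos (by positivity) hneg
    linarith
  -- otherwise both `Λ` and `m` are bounded, and not even one query is allowed
  have hlarge : 6 ≤ κ * Λ := by
    by_contra! hsmall
    have hΛle : Λ < 6 / κ := by rw [lt_div_iff₀ hκ]; linarith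
    have hmle : (m : ℝ) ≤ Real.exp (12 / κ) := by
      rw [← Real.log_le_iff_le_exp hm']
      have h1 := Real.log_le_log hε h
      rw [Real.log_rpow hm', hlogε] at h1
      have h2 : 12 / κ = 2 * (6 / κ) := by ring
      nlinarith [Real.log_nonneg (Nat.one_le_cast.2 hm : (1 : ℝ) ≤ m)]
    have h1 : Real.exp (-(12 / κ)) * m ≤ 1 := by
      rw [Real.exp_neg, inv_mul_le_iff₀ (Real.exp_pos _)]; linarith
    have h2 : κ / 72 * Real.exp (-(12 / κ)) * m * Λ =
      (Real.exp (-(12 / κ)) * m) * (κ * Λ) / 72 := by ring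
    have h3 : (Real.exp (-(12 / κ)) * m) * (κ * Λ) ≤ 1 * (κ * Λ) :=
      mul_le_mul_of_nonneg_right h1 (by positivity)
    linarith
  have hlog8 : Real.log 8 < 3 := by
    rw [show (8 : ℝ) = 2 ^ 3 by norm_num, Real.log_pow]
    have := Real.log_two_lt_d9
    push_cast
    linarith
  refine ⟨⌈κ * Λ / 3⌉₊ - 1, ?_, ?_⟩
  · refine (mul_sqrt_le_rpow hα hm hε h).trans_lt ?_
    have hK : ((⌈κ * Λ / 3⌉₊ - 1 : ℕ) : ℝ) < κ * Λ / 3 := by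
      rw [← Nat.lt_ceil]
      have : 0 < ⌈κ * Λ / 3⌉₊ := Nat.ceil_pos.2 (by positivity)
      omega
    rw [← Real.log_lt_log_iff (Real.rpow_pos_of_pos hε _) (by positivity), Real.log_rpow hε,
      Real.log_pow, hlogε, show Real.log (1 / 8) = -Real.log 8 by rw [one_div, Real.log_inv]]
    have hK0 : (0 : ℝ) ≤ ((⌈κ * Λ / 3⌉₊ - 1 : ℕ) : ℝ) := Nat.cast_nonneg _
    nlinarith
  · have hK : κ * Λ / 6 ≤ ((⌈κ * Λ / 3⌉₊ - 1 : ℕ) : ℝ) := by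
      have h1 := Nat.le_ceil (κ * Λ / 3)
      have h2 : (⌈κ * Λ / 3⌉₊ : ℝ) ≤ ((⌈κ * Λ / 3⌉₊ - 1 : ℕ) : ℝ) + 1 := by
        exact_mod_cast (by omega : ⌈κ * Λ / 3⌉₊ ≤ ⌈κ * Λ / 3⌉₊ - 1 + 1)
      linarith
    have h1 : κ / 72 * Real.exp (-(12 / κ)) * m * Λ ≤ κ / 72 * 1 * m * Λ := by gcongr
    have h2 := mul_le_mul_of_nonneg_left hK hm'.le
    have h3 : (12 * T : ℝ) ≤ m * ((⌈κ * Λ / 3⌉₊ - 1 : ℕ) : ℝ) := by linarith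
    exact_mod_cast h3

lemma two_pow_mul_le {T u : ℕ} (hT : 1 ≤ T) (hu : 12 * T ≤ u) :
    (2 : ℝ) ^ T * (3 / 4) ^ u ≤ 1 / 7 := by
  calc (2 : ℝ) ^ T * (3 / 4) ^ u ≤ 2 ^ T * (3 / 4) ^ (12 * T) :=
        mul_le_mul_of_nonneg_left (pow_le_pow_of_le_one (by norm_num) (by norm_num) hu)
          (by positivity)
    _ = (2 * (3 / 4) ^ 12) ^ T := by rw [pow_mul, mul_pow]
    _ ≤ (2 * (3 / 4) ^ 12) ^ 1 := pow_le_pow_of_le_one (by norm_num) (by norm_num) hT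
    _ ≤ 1 / 7 := by norm_num

theorem mainTheorem4 :
    ∀ α : ℝ, 1 / 2 < α → ∃ c : ℝ, 0 < c ∧
      ∀ (n D : ℕ) (S : Fin n → Finset (Fin D)),
      (∀ i j, i ≠ j → Disjoint (S i) (S j)) →
      ∀ (m : ℕ), m = ∑ i, (S i).card →
      ∀ (L : ℝ≥0) (R ε : ℝ) (x₀ : EuclideanSpace ℝ (Fin D)),
      0 < L → 0 < R → 0 < ε → ε ≤ (m : ℝ) ^ (-α) →
      -- a randomized algorithm, i.e. a random deterministic one, and a budget of queries
      ∀ (Ω : Type*) [MeasurableSpace Ω] (μ : MeasureTheory.Measure Ω)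
        [MeasureTheory.IsProbabilityMeasure μ] (A : Ω → QueryAlgorithm n D) (T : ℕ),
      (T : ℝ) < c * m * Real.log (1 / ε) →
      ∃ (f : Fin n → EuclideanSpace ℝ (Fin D) → ℝ)
        (g : Fin n → EuclideanSpace ℝ (Fin D) → EuclideanSpace ℝ (Fin D))
        (xopt : EuclideanSpace ℝ (Fin D)),
        IsDecomposableInstance S L R x₀ f xopt ∧ IsSubgradientOracle f g ∧
        1 / 3 < μ {ω | ¬ ((A ω).numQueries f g ≤ T ∧
          ∑ i, f i ((A ω).result f g) ≤ ε * L * R + ∑ i, f i xopt)} := by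
  intro α hα
  have hκ : 0 < 1 - 1 / (2 * α) := by
    rw [sub_pos, div_lt_one (by linarith)]; linarith
  refine ⟨(1 - 1 / (2 * α)) / 72 * Real.exp (-(12 / (1 - 1 / (2 * α)))), by positivity, ?_⟩
  intro n D S hS m hm L R ε x₀ hL hR hε hεm Ω _ μ _ A T hT
  have hmU : m = (Finset.univ.biUnion S).card := by
    rw [hm, Finset.card_biUnion fun i _ j _ hij => hS i j hij]
  have hm0 : 0 < m := by
    refine Nat.pos_of_ne_zero fun h => ?_
    rw [h, Nat.cast_zero, Real.zero_rpow (by linarith)] at hεm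
    linarith
  rcases T.eq_zero_or_pos with rfl | hTpos
  · refine exists_hard_instance_of_zero_queries hmU hL hR hm0 ?_ μ A
    have hε1 : ε < 1 := by
      by_contra! h
      have : Real.log (1 / ε) ≤ 0 := Real.log_nonpos (by positivity) ((div_le_one hε).2 h)
      have := mul_nonpos_of_nonneg_of_nonpos (show 0 ≤ (1 - 1 / (2 * α)) / 72 *
        Real.exp (-(12 / (1 - 1 / (2 * α)))) * (m : ℝ) by positivity) this
      rw [Nat.cast_zero] at hT
      linarith
    exact (mul_sqrt_le_rpow hα hm0 hε hεm).trans_lt (Real.rpow_lt_one hε.le hε1 hκ)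
  · obtain ⟨K, hK, hTK⟩ := exists_depth hα hm0 hε hεm hTpos hT
    exact exists_hard_instance hmU hL hR hm0 hK (two_pow_mul_le hTpos hTK) μ A
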